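/- For $n\ge 1$ and a labeled simple graph $G$ on $n$ nodes let $t(G)=\big(|\mathrm{hom}(K_2,G)|/n^2,\ |\mathrm{hom}(K_3,G)|/n^3\big)\in\mathbb R^2$ be the vector of its edge and triangle homomorphism densities, and for $x\in\mathbb R^2$ let $\nu_n(x)$ be the number of labeled simple graphs $G$ on $n$ nodes with $t(G)=x$. For $k\ge 0$ let $v_k=\big(\tfrac{k}{k+1},\tfrac{k(k-1)}{(k+1)^2}\big)$, and let $l_k=(v_{k+1}-v_k)/\|v_{k+1}-v_k\|$, the unit vector that is a positive multiple of $\big(1,\tfrac{k(3k+5)}{(k+1)(k+2)}\big)$. For $\beta\in\mathbb R^2$ and $x\in\{v_k,v_{k+1}\}$ put $$\mathbb P_{n,k,\beta}(x)=\frac{e^{n^2\langle x,\beta\rangle}\,\nu_n(x)}{e^{n^2\langle v_k,\beta\rangle}\nu_n(v_k)+e^{n^2\langle v_{k+1},\beta\rangle}\nu_n(v_{k+1})}.$$ Fix an integer $k\ge 1$ and $\beta\in\mathbb R^2$, let $n_j=j(k+1)(k+2)$ for $j=1,2,\dots$, and let $$\rho_j=\frac{\mathbb P_{n_j,k,\beta}(v_{k+1})}{\mathbb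 P_{n_j,k,\beta}(v_k)},\qquad C_k(\beta)=\langle l_k,\beta\rangle\,\langle v_{k+1}-v_k,l_k\rangle .$$ Then: (1) as $j\to\infty$, $\rho_j\to\infty$ if $\langle l_k,\beta\rangle\ge 0$, and $\rho_j\to 0$ if $\langle l_k,\beta\rangle<0$; (2) $\langle v_{k+1}-v_k,l_k\rangle>0$, so that $C_k(\beta)$ has the sign of $\langle l_k,\beta\rangle$, and as $j\to\infty$ $$\frac{\log\rho_j}{n_j^2}\to C_k(\beta),\qquad \rho_j\asymp e^{n_j^2C_k(\beta)}\,\frac1{\sqrt{n_j}}\Big(\frac{k+2}{k+1}\Big)^{n_j};$$ thus the growth or decay is exponential in $n_j^2$ when $\langle l_k,\beta\rangle\neq0$; (3) for every $j\ge1$, $\nu_{n_j}(v_k)$ and $\nu_{n_j}(v_{k+1})$ are the numbers of labeled graphs on $n_j$ nodes isomorphic to the Turán graph with $k+1$, respectively $k+2$, classes, so that $$\nu_{n_j}(v_k)=\frac{n_j!}{(k+1)!\,[(j(k+2))!]^{k+1}},\qquad \nu_{n_j}(v_{k+1})=\frac{n_j!}{(k+2)!\,[(j(k+1))!]^{k+2}},$$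 and, as $j\to\infty$, $$\frac{\nu_{n_j}(v_{k+1})}{\nu_{n_j}(v_k)}\asymp\frac1{\sqrt{n_j}}\Big(\frac{k+2}{k+1}\Big)^{n_j}.$$ Here $a_j\asymp b_j$ means that $a_j/b_j$ is bounded between two positive constants for all large $j$. -/

import Mathlib

open Filter Topology Asymptotics

namespace EdgeTriangle

noncomputable section

/-- Homomorphism density `t(H, G) = |hom(H, G)| / |V(G)| ^ |V(H)|`. -/
def homDensity {m n : ℕ} (H : SimpleGraph (Fin m)) (G : SimpleGraph (Fin n)) : ℝ :=
  (Nat.card (H →g G) : ℝ) / (n : ℝ) ^ m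

/-- The vector of edge and triangle homomorphism densities of a labeled graph on `n` nodes. -/
def density {n : ℕ} (G : SimpleGraph (Fin n)) : EuclideanSpace ℝ (Fin 2) :=
  !₂[homDensity (⊤ : SimpleGraph (Fin 2)) G, homDensity (⊤ : SimpleGraph (Fin 3)) G]

/-- `ν_n(x)`: the number of labeled simple graphs on `n` nodes with density vector `x`. -/
def nu (n : ℕ) (x : EuclideanSpace ℝ (Fin 2)) : ℕ :=
  Nat.card {G : SimpleGraph (Fin n) // density G = x}

/-- The number of labeled graphs on `n` nodes isomorphic to the Turán graph with `r` classes. -/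
def turanCount (n r : ℕ) : ℕ :=
  Nat.card {G : SimpleGraph (Fin n) // Nonempty (G ≃g SimpleGraph.turanGraph n r)}

/-- The vertex `v_k = (k/(k+1), k(k-1)/(k+1)²)`, the edge and triangle densities of the Turán
graphon with `k + 1` classes. -/
def vertex (k : ℕ) : EuclideanSpace ℝ (Fin 2) :=
  !₂[(k : ℝ) / (k + 1), (k : ℝ) * (k - 1) / (k + 1) ^ 2]

/-- The unit vector `l_k` parallel to the segment from `v_k` to `v_{k+1}`; it is a positive
multiple of `(1, k(3k+5)/((k+1)(k+2)))`. -/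
def unitDir (k : ℕ) : EuclideanSpace ℝ (Fin 2) :=
  ‖vertex (k + 1) - vertex k‖⁻¹ • (vertex (k + 1) - vertex k)

open Classical in
/-- The two-point exponential family `P_{n,k,β}` supported on `{v_k, v_{k+1}}`, with base
measure `ν_n`. -/
def twoPointProb (n k : ℕ) (β x : EuclideanSpace ℝ (Fin 2)) : ℝ :=
  if x = vertex k ∨ x = vertex (k + 1) then
    Real.exp ((n : ℝ) ^ 2 * inner ℝ x β) * (nu n x : ℝ) /
      (Real.exp ((n : ℝ) ^ 2 * inner ℝ (vertex k) β) * (nu n (vertex k) : ℝ) +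
        Real.exp ((n : ℝ) ^ 2 * inner ℝ (vertex (k + 1)) β) * (nu n (vertex (k + 1)) : ℝ))
  else 0

/-- The subsequence `n_j = j (k+1) (k+2)`. -/
def nSeq (k j : ℕ) : ℕ := j * (k + 1) * (k + 2)

/-- The ratio `P_{n_j,k,β}(v_{k+1}) / P_{n_j,k,β}(v_k)`. -/
def probRatio (k : ℕ) (β : EuclideanSpace ℝ (Fin 2)) (j : ℕ) : ℝ :=
  twoPointProb (nSeq k j) k β (vertex (k + 1)) / twoPointProb (nSeq k j) k β (vertex k)

/-- The rate constant `C_k(β) = ⟨l_k, β⟩ ⟨v_{k+1} - v_k, l_k⟩`. -/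
def rate (k : ℕ) (β : EuclideanSpace ℝ (Fin 2)) : ℝ :=
  inner ℝ (unitDir k) β * inner ℝ (vertex (k + 1) - vertex k) (unitDir k)

end

end EdgeTriangle

/-! The normalising constant cancels in `ρ_j`, which becomes `exp (n² C_k(β))` times the quotient of
the two counts `ν_n` (`probRatio_eq`); the work is to identify these counts. The point `v_k` lies on
Goodman's curve `t₃ = t₂ (2 t₂ - 1)`. By Goodman's identity (`card_hom_top_three_eq`) the excess
over that curve is a sum of two nonnegative terms, one measuring irregularity of the degrees, the
other failure of transitivity of non-adjacency. Both vanish at `v_k`, so for `k + 1 ∣ n` the graphs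
counted are complete multipartite with `k + 1` equal classes (`density_eq_vertex_iff`). Such graphs
are balanced maps to class labels, modulo relabelling (`turanCount_mul`). Stirling's formula then
gives the quotient of the counts up to constants (`nu_ratio_isTheta`): it is `exp (O(n))`, hence
invisible at scale `n²`, yet it diverges and so decides the case `⟨l_k, β⟩ = 0`. -/

namespace EdgeTriangle

/-! ### Balanced maps and the enumeration of Turán graphs -/

/-- A function all of whose fibres have exactly `m` elements. -/
def IsBalanced {V ι : Type*} (m : ℕ) (f : V → ι) : Prop :=
  ∀ i, Nat.card {v // f v = i} = m

/-- The complete multipartite graph whose classes are the fibres of `f`. -/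
def multipartite {V ι : Type*} (f : V → ι) : SimpleGraph V :=
  (⊤ : SimpleGraph ι).comap f

theorem multipartite_adj {V ι : Type*} (f : V → ι) (u v : V) :
    (multipartite f).Adj u v ↔ f u ≠ f v := by
  simp [multipartite]

theorem card_eq_mul_of_card_fiber {α β : Type*} [Finite α] [Finite β] (φ : α → β) (c : ℕ)
    (h : ∀ b, Nat.card {a // φ a = b} = c) : Nat.card α = Nat.card β * c := by
  cases nonempty_fintype β
  rw [← Nat.card_congr (Equiv.sigmaFiberEquiv φ), Nat.card_sigma]
  simp [h]

theorem IsBalanced.card_eq {V ι : Type*} [Finite V] [Finite ι] {m : ℕ} {f : V → ι}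
    (hf : IsBalanced m f) : Nat.card V = Nat.card ι * m :=
  card_eq_mul_of_card_fiber f m hf

theorem IsBalanced.surjective {V ι : Type*} {m : ℕ} (hm : m ≠ 0) {f : V → ι}
    (hf : IsBalanced m f) : Function.Surjective f := by
  intro i
  have h : Nat.card {v // f v = i} ≠ 0 := by rw [hf i]; exact hm
  obtain ⟨v, hv⟩ := (Nat.card_ne_zero.1 h).1
  exact ⟨v, hv⟩

theorem IsBalanced.comp_perm {V ι : Type*} {m : ℕ} {f : V → ι} (hf : IsBalanced m f)
    (σ : Equiv.Perm V) : IsBalanced m (f ∘ σ) := by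
  intro i
  rw [← hf i]
  exact Nat.card_congr (σ.subtypeEquiv fun v => Iff.rfl)

theorem IsBalanced.perm_comp {V ι : Type*} {m : ℕ} {f : V → ι} (hf : IsBalanced m f)
    (τ : Equiv.Perm ι) : IsBalanced m (τ ∘ f) := by
  intro i
  rw [← hf (τ.symm i)]
  exact Nat.card_congr (Equiv.subtypeEquivRight fun v => by simp [Equiv.eq_symm_apply])

theorem IsBalanced.exists_perm {V ι : Type*} [Finite V] {m : ℕ} {f g : V → ι}
    (hf : IsBalanced m f) (hg : IsBalanced m g) : ∃ σ : Equiv.Perm V, g ∘ σ = f := by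
  have e : ∀ i, Nonempty ({v // f v = i} ≃ {v // g v = i}) := fun i =>
    Finite.card_eq.1 ((hf i).trans (hg i).symm)
  refine ⟨(Equiv.sigmaFiberEquiv f).symm.trans
    ((Equiv.sigmaCongrRight fun i => (e i).some).trans (Equiv.sigmaFiberEquiv g)), ?_⟩
  funext v
  exact ((e (f v)).some ⟨v, rfl⟩).2

-- Orbit-stabilizer: permutations of `V` act transitively on balanced maps by precomposition, and
-- the stabilizer of `g` permutes each fibre separately.
open Nat in
theorem card_isBalanced_mul {V ι : Type*} [Finite V] [Finite ι] {m : ℕ} {g : V → ι}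
    (hg : IsBalanced m g) :
    (Nat.card V)! = Nat.card {f : V → ι // IsBalanced m f} * m ! ^ Nat.card ι := by
  classical
  cases nonempty_fintype V
  cases nonempty_fintype ι
  have key := card_eq_mul_of_card_fiber
    (fun σ : Equiv.Perm V => (⟨g ∘ σ, hg.comp_perm σ⟩ : {f : V → ι // IsBalanced m f}))
    (m ! ^ Nat.card ι) ?_
  · rwa [Nat.card_perm] at key
  · rintro ⟨f, hf⟩
    obtain ⟨τ, rfl⟩ := hf.exists_perm hg
    -- Right translation by `τ⁻¹` carries the permutations sending `g` to `g ∘ τ` onto the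
    -- stabilizer of `g`.
    have : {σ : Equiv.Perm V // (⟨g ∘ σ, hg.comp_perm σ⟩ : {f : V → ι // IsBalanced m f})
        = ⟨g ∘ τ, hf⟩} ≃ {σ : Equiv.Perm V // g ∘ σ = g} :=
      (Equiv.mulRight τ⁻¹).subtypeEquiv fun σ => by
        simp only [Subtype.mk.injEq, funext_iff, Function.comp_apply, Equiv.coe_mulRight,
          Equiv.Perm.coe_mul]
        refine ⟨fun h v => by simp [h], fun h v => by simpa using h (τ v)⟩
    rw [Nat.card_congr this, Nat.card_eq_fintype_card, DomMulAct.stabilizer_card]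
    simp only [← Nat.card_eq_fintype_card, hg _]
    simp

/-- The graph remembers the partition into fibres, hence the map up to the names of the classes; `τ`
is read off from a section of `g`. -/
theorem exists_perm_of_multipartite_eq {V ι : Type*} {f g : V → ι}
    (hf : Function.Surjective f) (hg : Function.Surjective g)
    (h : multipartite f = multipartite g) : ∃ τ : Equiv.Perm ι, τ ∘ g = f := by
  have hfg : ∀ u v, f u = f v ↔ g u = g v := fun u v => by
    have := congrArg (fun G => G.Adj u v) h
    simp only [multipartite_adj, ne_eq, eq_iff_iff] at this
    exact not_iff_not.1 this
  refine ⟨Equiv.ofBijective (fun i => f (Function.surjInv hg i)) ⟨fun i j hij => ?_, fun i => ?_⟩,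
    ?_⟩
  · have := (hfg _ _).1 hij
    rwa [Function.surjInv_eq hg, Function.surjInv_eq hg] at this
  · obtain ⟨v, rfl⟩ := hf i
    exact ⟨g v, (hfg _ _).2 (Function.surjInv_eq hg _)⟩
  · funext v
    exact (hfg _ _).2 (Function.surjInv_eq hg _)

theorem multipartite_perm_comp {V ι : Type*} (f : V → ι) (τ : Equiv.Perm ι) :
    multipartite (τ ∘ f) = multipartite f := by
  ext u v
  simp [multipartite_adj]

-- Relabelling the classes acts simply transitively on the balanced maps inducing a given graph.
-- Freeness needs every class to be nonempty, whence `m ≠ 0`.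
open Nat in
theorem card_isBalanced_eq {V ι : Type*} [Finite V] [Finite ι] {m : ℕ} (hm : m ≠ 0) :
    Nat.card {f : V → ι // IsBalanced m f} =
      Nat.card {G : SimpleGraph V // ∃ f : V → ι, IsBalanced m f ∧ G = multipartite f} *
        (Nat.card ι)! := by
  refine card_eq_mul_of_card_fiber (fun f => ⟨multipartite f.1, f.1, f.2, rfl⟩) _ ?_
  rintro ⟨G, g, hg, rfl⟩
  rw [← Nat.card_perm]
  symm
  refine Nat.card_congr (Equiv.ofBijective
    (fun τ => ⟨⟨τ ∘ g, hg.perm_comp τ⟩, by simp [multipartite_perm_comp]⟩) ⟨?_, ?_⟩)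
  · intro τ τ' h
    ext i
    obtain ⟨v, rfl⟩ := hg.surjective hm i
    have h' : τ ∘ g = τ' ∘ g := congrArg (fun x => x.1.1) h
    exact congrFun h' v
  · rintro ⟨⟨f, hf⟩, h⟩
    obtain ⟨τ, rfl⟩ := exists_perm_of_multipartite_eq (hf.surjective hm) (hg.surjective hm)
      (congrArg Subtype.val h)
    exact ⟨τ, rfl⟩

theorem isBalanced_modNat (m r : ℕ) : IsBalanced m (fun v : Fin (m * r) => v.modNat) := by
  intro i
  have e : {v : Fin (m * r) // v.modNat = i} ≃ Fin m :=
    (finProdFinEquiv.symm.subtypeEquiv (q := fun p : Fin m × Fin r => p.2 = i)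
      fun v => Iff.rfl).trans
      { toFun := fun p => p.1.1
        invFun := fun a => ⟨(a, i), rfl⟩
        left_inv := by rintro ⟨⟨a, b⟩, rfl⟩; rfl
        right_inv := fun a => rfl }
  rw [Nat.card_congr e, Nat.card_fin]

theorem turanGraph_eq_multipartite (m r : ℕ) :
    SimpleGraph.turanGraph (m * r) r = multipartite (fun v : Fin (m * r) => v.modNat) := by
  ext u v
  simp [multipartite_adj, SimpleGraph.turanGraph, Fin.ext_iff, Fin.modNat]

theorem nonempty_iso_turanGraph_iff {m r : ℕ} (G : SimpleGraph (Fin (m * r))) :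
    Nonempty (G ≃g SimpleGraph.turanGraph (m * r) r) ↔
      ∃ f : Fin (m * r) → Fin r, IsBalanced m f ∧ G = multipartite f := by
  rw [turanGraph_eq_multipartite]
  constructor
  · rintro ⟨e⟩
    refine ⟨fun v => (e v).modNat, (isBalanced_modNat m r).comp_perm e.toEquiv, ?_⟩
    ext u v
    rw [← e.map_adj_iff, multipartite_adj, multipartite_adj]
  · rintro ⟨f, hf, rfl⟩
    obtain ⟨σ, hσ⟩ := hf.exists_perm (isBalanced_modNat m r)
    exact ⟨σ, fun {u v} => by simp only [multipartite_adj, ← hσ, Function.comp_apply]⟩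

open Nat in
theorem turanCount_mul {m r : ℕ} (hm : m ≠ 0) :
    turanCount (m * r) r * (r ! * m ! ^ r) = (m * r)! := by
  have h₁ := card_isBalanced_mul (isBalanced_modNat m r)
  have h₂ := card_isBalanced_eq (V := Fin (m * r)) (ι := Fin r) hm
  simp only [Nat.card_fin] at h₁ h₂
  rw [h₁, h₂, turanCount]
  simp only [nonempty_iso_turanGraph_iff]
  ring

open Nat in
theorem turanCount_eq_div {m r : ℕ} (hm : m ≠ 0) :
    (turanCount (m * r) r : ℝ) = ((m * r)! : ℝ) / ((r ! : ℝ) * (m ! : ℝ) ^ r) := by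
  rw [eq_div_iff (by positivity)]
  exact_mod_cast turanCount_mul hm

/-! ### Goodman's identity and its equality case -/

section Goodman

variable {V : Type*}

/-- Homomorphisms from an edge are the ordered pairs of adjacent vertices. -/
def homTopTwoEquiv (G : SimpleGraph V) :
    ((⊤ : SimpleGraph (Fin 2)) →g G) ≃ {p : V × V // G.Adj p.1 p.2} where
  toFun φ := ⟨(φ 0, φ 1), φ.map_adj (by simp)⟩
  invFun p := ⟨![p.1.1, p.1.2], fun {a b} hab => by
    have h := p.2
    have h' := p.2.symm
    fin_cases a <;> fin_cases b <;> simp_all⟩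
  left_inv φ := by
    ext i
    fin_cases i <;> rfl
  right_inv p := rfl

/-- Homomorphisms from a triangle are the ordered triples of pairwise adjacent vertices. -/
def homTopThreeEquiv (G : SimpleGraph V) :
    ((⊤ : SimpleGraph (Fin 3)) →g G) ≃
      {p : V × V × V // G.Adj p.1 p.2.1 ∧ G.Adj p.1 p.2.2 ∧ G.Adj p.2.1 p.2.2} where
  toFun φ := ⟨(φ 0, φ 1, φ 2), φ.map_adj (by simp), φ.map_adj (by simp), φ.map_adj (by simp)⟩
  invFun p := ⟨![p.1.1, p.1.2.1, p.1.2.2], fun {a b} hab => by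
    obtain ⟨h₁, h₂, h₃⟩ := p.2
    have h₁' := h₁.symm
    have h₂' := h₂.symm
    have h₃' := h₃.symm
    fin_cases a <;> fin_cases b <;> simp_all⟩
  left_inv φ := by
    ext i
    fin_cases i <;> rfl
  right_inv p := rfl

variable (G : SimpleGraph V) [DecidableRel G.Adj]

/-- The real adjacency indicator of a graph. -/
def adjInd (u v : V) : ℝ := if G.Adj u v then 1 else 0

theorem adjInd_comm (u v : V) : adjInd G u v = adjInd G v u := by
  simp [adjInd, G.adj_comm u v]

theorem adjInd_nonneg (u v : V) : 0 ≤ adjInd G u v := by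
  unfold adjInd; split_ifs <;> norm_num

theorem adjInd_le_one (u v : V) : adjInd G u v ≤ 1 := by
  unfold adjInd; split_ifs <;> norm_num

variable [Fintype V]

/-- The degree of a vertex as a real number. -/
noncomputable def realDegree (u : V) : ℝ := ∑ v, adjInd G u v

theorem card_hom_top_two :
    (Nat.card ((⊤ : SimpleGraph (Fin 2)) →g G) : ℝ) = ∑ u, realDegree G u := by
  rw [Nat.card_congr (homTopTwoEquiv G), Nat.card_eq_fintype_card, Fintype.card_subtype,
    Finset.card_filter]
  push_cast
  rw [Fintype.sum_prod_type]
  rfl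

theorem card_hom_top_three :
    (Nat.card ((⊤ : SimpleGraph (Fin 3)) →g G) : ℝ) =
      ∑ u, ∑ v, ∑ w, adjInd G u v * adjInd G u w * adjInd G v w := by
  rw [Nat.card_congr (homTopThreeEquiv G), Nat.card_eq_fintype_card, Fintype.card_subtype,
    Finset.card_filter]
  push_cast
  simp only [Fintype.sum_prod_type]
  refine Finset.sum_congr rfl fun u _ => Finset.sum_congr rfl fun v _ =>
    Finset.sum_congr rfl fun w _ => ?_
  simp only [adjInd]
  split_ifs <;> simp_all

/-- Goodman's identity: the number of triangles in terms of the degrees and of the number of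
pairs formed by an edge and a vertex adjacent to neither of its ends. -/
theorem card_hom_top_three_eq :
    (Nat.card ((⊤ : SimpleGraph (Fin 3)) →g G) : ℝ) =
      2 * ∑ u, realDegree G u ^ 2 - Fintype.card V * ∑ u, realDegree G u +
        ∑ u, ∑ v, ∑ w, adjInd G u v * ((1 - adjInd G u w) * (1 - adjInd G v w)) := by
  have h₁ : ∑ u, ∑ v, ∑ _w : V, adjInd G u v = Fintype.card V * ∑ u, realDegree G u := by
    simp [realDegree, Finset.mul_sum]
  have h₂ : ∑ u, ∑ v, ∑ w, adjInd G u v * adjInd G u w = ∑ u, realDegree G u ^ 2 := by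
    simp [realDegree, sq, Finset.sum_mul_sum]
  have h₃ : ∑ u, ∑ v, ∑ w, adjInd G u v * adjInd G v w = ∑ u, realDegree G u ^ 2 := by
    rw [Finset.sum_comm, ← h₂]
    refine Finset.sum_congr rfl fun u _ => Finset.sum_congr rfl fun v _ =>
      Finset.sum_congr rfl fun w _ => ?_
    rw [adjInd_comm]
  have h₄ : ∑ u, ∑ v, ∑ w, adjInd G u v * ((1 - adjInd G u w) * (1 - adjInd G v w)) =
      ∑ u, ∑ v, ∑ _w : V, adjInd G u v - ∑ u, ∑ v, ∑ w, adjInd G u v * adjInd G u w -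
        ∑ u, ∑ v, ∑ w, adjInd G u v * adjInd G v w +
          ∑ u, ∑ v, ∑ w, adjInd G u v * adjInd G u w * adjInd G v w := by
    simp only [← Finset.sum_sub_distrib, ← Finset.sum_add_distrib]
    refine Finset.sum_congr rfl fun u _ => Finset.sum_congr rfl fun v _ =>
      Finset.sum_congr rfl fun w _ => ?_
    ring
  rw [card_hom_top_three, h₄, h₁, h₂, h₃]
  ring

/-- The equality case of Goodman's bound: a graph with average degree `d` attains it exactly when
it is `d`-regular and every vertex is adjacent to an end of every edge. -/
theorem goodman_equality_iff (d : ℝ) :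
    (∑ u, realDegree G u = Fintype.card V * d ∧
      (Nat.card ((⊤ : SimpleGraph (Fin 3)) →g G) : ℝ) =
        Fintype.card V * d * (2 * d - Fintype.card V)) ↔
    (∀ u, realDegree G u = d) ∧
      ∀ u v w, ¬ G.Adj u w → ¬ G.Adj v w → ¬ G.Adj u v := by
  have hnn : ∀ u v w, 0 ≤ adjInd G u v * ((1 - adjInd G u w) * (1 - adjInd G v w)) :=
    fun u v w => mul_nonneg (adjInd_nonneg ..)
      (mul_nonneg (sub_nonneg.2 (adjInd_le_one ..)) (sub_nonneg.2 (adjInd_le_one ..)))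
  set T := ∑ u, ∑ v, ∑ w, adjInd G u v * ((1 - adjInd G u w) * (1 - adjInd G v w)) with hT
  have hT0 : 0 ≤ T := Finset.sum_nonneg fun u _ => Finset.sum_nonneg fun v _ =>
    Finset.sum_nonneg fun w _ => hnn u v w
  have hTiff : T = 0 ↔ ∀ u v w, ¬ G.Adj u w → ¬ G.Adj v w → ¬ G.Adj u v := by
    rw [hT, Fintype.sum_eq_zero_iff_of_nonneg]
    · simp only [funext_iff, Pi.zero_apply]
      refine forall_congr' fun u => ?_
      rw [Fintype.sum_eq_zero_iff_of_nonneg]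
      · simp only [funext_iff, Pi.zero_apply]
        refine forall_congr' fun v => ?_
        rw [Fintype.sum_eq_zero_iff_of_nonneg]
        · simp only [funext_iff, Pi.zero_apply]
          refine forall_congr' fun w => ?_
          simp only [adjInd]
          split_ifs <;> simp_all
        · exact fun w => hnn u v w
      · exact fun v => Finset.sum_nonneg fun w _ => hnn u v w
    · exact fun u => Finset.sum_nonneg fun v _ => Finset.sum_nonneg fun w _ => hnn u v w
  have hS : ∑ u, (realDegree G u - d) ^ 2 =
      ∑ u, realDegree G u ^ 2 - 2 * d * ∑ u, realDegree G u + Fintype.card V * d ^ 2 := by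
    simp only [sub_sq, Finset.sum_add_distrib, Finset.sum_sub_distrib, Finset.sum_const,
      Finset.card_univ, nsmul_eq_mul, Finset.mul_sum]
    congr 2
    exact Finset.sum_congr rfl fun u _ => by ring
  have hS0 : 0 ≤ ∑ u, (realDegree G u - d) ^ 2 := Finset.sum_nonneg fun u _ => sq_nonneg _
  have hSiff : ∑ u, (realDegree G u - d) ^ 2 = 0 ↔ ∀ u, realDegree G u = d := by
    rw [Fintype.sum_eq_zero_iff_of_nonneg (fun u => sq_nonneg _)]
    simp [funext_iff, sub_eq_zero]
  rw [card_hom_top_three_eq, ← hT, ← hTiff]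
  constructor
  · rintro ⟨h₁, h₂⟩
    rw [h₁] at h₂ hS
    -- Given the edge count, the triangle count is its target plus `2 ∑ (deg u - d)² + T`, a sum of
    -- two nonnegative terms.
    have : ∑ u, (realDegree G u - d) ^ 2 = 0 := by linarith
    exact ⟨hSiff.1 this, by linarith⟩
  · rintro ⟨h₁, h₂⟩
    have h₃ : ∑ u, realDegree G u = Fintype.card V * d := by simp [h₁]
    refine ⟨h₃, ?_⟩
    rw [← hSiff, hS, h₃] at h₁
    rw [h₃, h₂]
    linarith

theorem card_sub_realDegree (u : V) :
    (Fintype.card V : ℝ) - realDegree G u = Nat.card {v // ¬ G.Adj u v} := by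
  rw [Nat.card_eq_fintype_card, Fintype.card_subtype, Finset.card_filter, realDegree]
  push_cast
  rw [sub_eq_iff_eq_add, ← Finset.sum_add_distrib]
  simp only [adjInd]
  rw [Finset.sum_congr rfl (g := fun _ => (1 : ℝ)) fun v _ => by split_ifs <;> simp]
  simp

end Goodman

/-! ### Graphs with density vector `v_k` and their number -/

/-- A graph in which non-adjacency is transitive and every vertex has `m` non-neighbours
(itself included) is complete multipartite with classes of size `m`. -/
theorem exists_isBalanced_iff {V : Type*} [Finite V] {m r : ℕ} (hm : m ≠ 0)
    (hV : Nat.card V = m * r) (G : SimpleGraph V) :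
    (∃ f : V → Fin r, IsBalanced m f ∧ G = multipartite f) ↔
      (∀ u, Nat.card {v // ¬ G.Adj u v} = m) ∧
        ∀ u v w, ¬ G.Adj u w → ¬ G.Adj v w → ¬ G.Adj u v := by
  constructor
  · rintro ⟨f, hf, rfl⟩
    simp only [multipartite_adj, not_not]
    refine ⟨fun u => ?_, fun u v w h h' => h.trans h'.symm⟩
    rw [← hf (f u)]
    exact Nat.card_congr (Equiv.subtypeEquivRight fun v => eq_comm)
  · rintro ⟨hcard, htrans⟩
    let s : Setoid V :=
      { r := fun u v => ¬ G.Adj u v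
        iseqv := ⟨fun u => G.loopless.irrefl u, fun h h' => h h'.symm, fun {u v w} h h' =>
          htrans u w v h fun h'' => h' h''.symm⟩ }
    have hs : IsBalanced m (Quotient.mk s) := by
      intro q
      induction q using Quotient.inductionOn with
      | h u =>
        rw [← hcard u]
        exact Nat.card_congr (Equiv.subtypeEquivRight fun v => by
          rw [Quotient.eq]
          exact ⟨fun h h' => h h'.symm, fun h h' => h h'.symm⟩)
    have hq : Nat.card (Quotient s) = Nat.card (Fin r) := by
      have := hs.card_eq
      rw [hV, mul_comm] at this
      rw [Nat.card_fin]
      exact (Nat.eq_of_mul_eq_mul_right (Nat.pos_of_ne_zero hm) this).symm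
    obtain ⟨e⟩ := Finite.card_eq.1 hq
    refine ⟨e ∘ Quotient.mk s, fun i => ?_, ?_⟩
    · rw [← hs (e.symm i)]
      exact Nat.card_congr (Equiv.subtypeEquivRight fun v => by simp [Equiv.eq_symm_apply])
    · ext u v
      rw [multipartite_adj, Function.comp_apply, Function.comp_apply, e.injective.ne_iff, ne_eq,
        Quotient.eq]
      exact not_not.symm

/-- With `n = m (k + 1)` and `d = m k`, the two coordinates of `v_k` are exactly `n d / n²` and `n d
(2 d - n) / n³`, the equality case of Goodman's bound. -/
theorem density_eq_vertex_iff {m k : ℕ} (hm : m ≠ 0) (G : SimpleGraph (Fin (m * (k + 1)))) :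
    density G = vertex k ↔
      Nonempty (G ≃g SimpleGraph.turanGraph (m * (k + 1)) (k + 1)) := by
  classical
  rw [nonempty_iso_turanGraph_iff, exists_isBalanced_iff hm (by simp)]
  have hm' : (m : ℝ) ≠ 0 := by exact_mod_cast hm
  have hk : (k : ℝ) + 1 ≠ 0 := by positivity
  -- A vertex is its own non-neighbour, so `m` non-neighbours mean degree `n - m = m k`.
  have hdeg : (∀ u, Nat.card {v // ¬ G.Adj u v} = m) ↔ ∀ u, realDegree G u = m * k := by
    refine forall_congr' fun u => ?_
    have := card_sub_realDegree G u
    rw [← Nat.cast_inj (R := ℝ), ← this, Fintype.card_fin]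
    push_cast
    constructor <;> intro h <;> linarith
  rw [hdeg, ← goodman_equality_iff, ← card_hom_top_two, Fintype.card_fin]
  have hv : density G = vertex k ↔
      homDensity (⊤ : SimpleGraph (Fin 2)) G = (k : ℝ) / (k + 1) ∧
        homDensity (⊤ : SimpleGraph (Fin 3)) G = (k : ℝ) * (k - 1) / (k + 1) ^ 2 := by
    constructor
    · intro h
      exact ⟨congrArg (fun x => x 0) h, congrArg (fun x => x 1) h⟩
    · rintro ⟨h₁, h₂⟩
      rw [density, vertex, h₁, h₂]
  rw [hv, homDensity, homDensity]
  push_cast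
  refine and_congr ?_ ?_
  · rw [div_eq_iff (by positivity)]
    refine Eq.congr_right ?_
    field_simp
  · rw [div_eq_iff (by positivity)]
    refine Eq.congr_right ?_
    field_simp
    ring

theorem nu_vertex {m k : ℕ} (hm : m ≠ 0) :
    nu (m * (k + 1)) (vertex k) = turanCount (m * (k + 1)) (k + 1) := by
  simp only [nu, turanCount, density_eq_vertex_iff hm]

/-- `n_j` is divisible by both `k + 1` and `k + 2`, so both Turán graphs have equal classes, of
sizes `j (k + 2)` and `j (k + 1)`. -/
theorem nSeq_eq_mul_left (k j : ℕ) : nSeq k j = j * (k + 2) * (k + 1) := by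
  unfold nSeq; ring

theorem nSeq_eq_mul_right (k j : ℕ) : nSeq k j = j * (k + 1) * (k + 1 + 1) := rfl

theorem nu_vertex_left {k j : ℕ} (hj : 1 ≤ j) :
    nu (nSeq k j) (vertex k) = turanCount (nSeq k j) (k + 1) := by
  rw [nSeq_eq_mul_left]
  exact nu_vertex (by positivity)

theorem nu_vertex_right {k j : ℕ} (hj : 1 ≤ j) :
    nu (nSeq k j) (vertex (k + 1)) = turanCount (nSeq k j) (k + 2) := by
  rw [nSeq_eq_mul_right]
  exact nu_vertex (by positivity)

open Nat in
theorem turanCount_left {k j : ℕ} (hj : 1 ≤ j) :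
    (turanCount (nSeq k j) (k + 1) : ℝ) =
      ((nSeq k j)! : ℝ) / (((k + 1)! : ℝ) * ((j * (k + 2))! : ℝ) ^ (k + 1)) := by
  rw [nSeq_eq_mul_left]
  exact turanCount_eq_div (by positivity)

open Nat in
theorem turanCount_right {k j : ℕ} (hj : 1 ≤ j) :
    (turanCount (nSeq k j) (k + 2) : ℝ) =
      ((nSeq k j)! : ℝ) / (((k + 2)! : ℝ) * ((j * (k + 1))! : ℝ) ^ (k + 2)) := by
  rw [nSeq_eq_mul_right]
  exact turanCount_eq_div (by positivity)

theorem nu_vertex_left_pos {k j : ℕ} (hj : 1 ≤ j) : (0 : ℝ) < nu (nSeq k j) (vertex k) := by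
  rw [nu_vertex_left hj, turanCount_left hj]
  positivity

theorem nu_vertex_right_pos {k j : ℕ} (hj : 1 ≤ j) :
    (0 : ℝ) < nu (nSeq k j) (vertex (k + 1)) := by
  rw [nu_vertex_right hj, turanCount_right hj]
  positivity

/-! ### Stirling asymptotics of the quotient of counts -/

open Nat in
theorem nu_ratio_eq {k j : ℕ} (hj : 1 ≤ j) :
    (nu (nSeq k j) (vertex (k + 1)) : ℝ) / nu (nSeq k j) (vertex k) =
      ((k : ℝ) + 2)⁻¹ *
        (((j * (k + 2))! : ℝ) ^ (k + 1) / ((j * (k + 1))! : ℝ) ^ (k + 2)) := by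
  rw [nu_vertex_left hj, nu_vertex_right hj, turanCount_left hj, turanCount_right hj,
    Nat.factorial_succ (k + 1)]
  push_cast
  field_simp
  ring

open Nat in
theorem factorial_isTheta_stirling :
    (fun n : ℕ => (n ! : ℝ)) =Θ[atTop]
      fun n : ℕ => √(2 * n * Real.pi) * (n / Real.exp 1) ^ n :=
  Stirling.factorial_isEquivalent_stirling.isTheta

/-- Both powers `(·/e)^(·)` have total exponent `n_j`, so `j` and `e` cancel there. The square-root
prefactors occur `k + 1` times above and `k + 2` times below, which leaves one factor `1/√j`. -/
theorem stirling_ratio_eq {k j : ℕ} (hj : 1 ≤ j) :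
    (√(2 * (j * (k + 2) : ℕ) * Real.pi) *
          ((j * (k + 2) : ℕ) / Real.exp 1) ^ (j * (k + 2))) ^ (k + 1) /
        (√(2 * (j * (k + 1) : ℕ) * Real.pi) *
          ((j * (k + 1) : ℕ) / Real.exp 1) ^ (j * (k + 1))) ^ (k + 2) =
      (√(2 * (k + 2) * Real.pi) ^ (k + 1) / √(2 * (k + 1) * Real.pi) ^ (k + 2) *
          √((k + 1) * (k + 2))) *
        (√(1 / (nSeq k j : ℝ)) * (((k : ℝ) + 2) / ((k : ℝ) + 1)) ^ nSeq k j) := by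
  have hj' : (0 : ℝ) < j := by exact_mod_cast hj
  have h₁ : √(2 * (j * (k + 2) : ℕ) * Real.pi) = √(j : ℝ) * √(2 * (k + 2) * Real.pi) := by
    rw [← Real.sqrt_mul hj'.le]; push_cast; congr 1; ring
  have h₂ : √(2 * (j * (k + 1) : ℕ) * Real.pi) = √(j : ℝ) * √(2 * (k + 1) * Real.pi) := by
    rw [← Real.sqrt_mul hj'.le]; push_cast; congr 1; ring
  have h₃ : √(1 / (nSeq k j : ℝ)) = (√(j : ℝ))⁻¹ * (√(((k : ℝ) + 1) * (k + 2)))⁻¹ := by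
    rw [← mul_inv, ← Real.sqrt_mul hj'.le, ← Real.sqrt_inv, nSeq]
    push_cast; rw [one_div, mul_assoc]
  have h₄ : (((j * (k + 2) : ℕ) : ℝ) / Real.exp 1) ^ (j * (k + 2) * (k + 1)) /
      (((j * (k + 1) : ℕ) : ℝ) / Real.exp 1) ^ (j * (k + 1) * (k + 2)) =
        (((k : ℝ) + 2) / ((k : ℝ) + 1)) ^ nSeq k j := by
    rw [nSeq, show j * (k + 2) * (k + 1) = j * (k + 1) * (k + 2) by ring, ← div_pow]
    congr 1
    push_cast
    field_simp
  rw [h₁, h₂, h₃, ← h₄]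
  have hs : √(j : ℝ) ≠ 0 := (Real.sqrt_pos.2 hj').ne'
  have hs' : √(((k : ℝ) + 1) * (k + 2)) ≠ 0 := (Real.sqrt_pos.2 (by positivity)).ne'
  have hs'' : √(2 * ((k : ℝ) + 1) * Real.pi) ≠ 0 := (Real.sqrt_pos.2 (by positivity)).ne'
  simp only [mul_pow, ← pow_mul]
  field_simp
  ring

theorem nu_ratio_isTheta (k : ℕ) :
    (fun j : ℕ => (nu (nSeq k j) (vertex (k + 1)) : ℝ) / (nu (nSeq k j) (vertex k) : ℝ)) =Θ[atTop]
      fun j : ℕ => √(1 / (nSeq k j : ℝ)) * (((k : ℝ) + 2) / ((k : ℝ) + 1)) ^ nSeq k j := by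
  have ht : ∀ c : ℕ, Tendsto (fun j : ℕ => j * (c + 1)) atTop atTop := fun c =>
    tendsto_id.atTop_mul_const' (Nat.succ_pos c)
  have h₁ : (fun j : ℕ => ((j * (k + 2)).factorial : ℝ)) =Θ[atTop] _ :=
    ⟨factorial_isTheta_stirling.1.comp_tendsto (ht (k + 1)),
      factorial_isTheta_stirling.2.comp_tendsto (ht (k + 1))⟩
  have h₂ : (fun j : ℕ => ((j * (k + 1)).factorial : ℝ)) =Θ[atTop] _ :=
    ⟨factorial_isTheta_stirling.1.comp_tendsto (ht k),
      factorial_isTheta_stirling.2.comp_tendsto (ht k)⟩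
  have h₃ := (h₁.pow (k + 1)).div (h₂.pow (k + 2))
  have hc : √(2 * ((k : ℝ) + 2) * Real.pi) ^ (k + 1) / √(2 * ((k : ℝ) + 1) * Real.pi) ^ (k + 2) *
          √(((k : ℝ) + 1) * (k + 2)) ≠ 0 := by positivity
  have hc' : ((k : ℝ) + 2)⁻¹ ≠ 0 := by positivity
  have h₄ := h₃.trans_eventuallyEq <|
    (eventually_ge_atTop 1).mono fun j hj => stirling_ratio_eq (k := k) hj
  have h₅ := (isTheta_const_mul_left hc').2 ((isTheta_const_mul_right hc).1 h₄)
  refine EventuallyEq.trans_isTheta ?_ h₅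
  exact (eventually_ge_atTop 1).mono fun j hj => nu_ratio_eq hj

/-! ### The direction `l_k` and the rate constant -/

theorem vertex_sub_apply_zero_pos (k : ℕ) : 0 < (vertex (k + 1) - vertex k) 0 := by
  simp only [vertex, PiLp.sub_apply]
  simp only [Nat.cast_add, Nat.cast_one, Matrix.cons_val_zero]
  rw [sub_pos, div_lt_div_iff₀ (by positivity) (by positivity)]
  nlinarith

theorem norm_vertex_sub_pos (k : ℕ) : 0 < ‖vertex (k + 1) - vertex k‖ := by
  rw [norm_pos_iff]
  intro h
  have := vertex_sub_apply_zero_pos k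
  rw [h] at this
  simp at this

theorem inner_vertex_sub_unitDir (k : ℕ) :
    inner ℝ (vertex (k + 1) - vertex k) (unitDir k) = ‖vertex (k + 1) - vertex k‖ := by
  have := norm_vertex_sub_pos k
  rw [unitDir, real_inner_smul_right, real_inner_self_eq_norm_sq]
  field_simp

/-- The two normalisations by `‖v_{k+1} - v_k‖` cancel, which leaves the difference of exponents
appearing in the probability ratio. -/
theorem rate_eq_inner (k : ℕ) (β : EuclideanSpace ℝ (Fin 2)) :
    rate k β = inner ℝ (vertex (k + 1)) β - inner ℝ (vertex k) β := by
  have := norm_vertex_sub_pos k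
  rw [rate, inner_vertex_sub_unitDir, unitDir, real_inner_smul_left, ← inner_sub_left]
  field_simp

/-! ### Asymptotics of the probability ratio -/

theorem probRatio_eq {k j : ℕ} (hj : 1 ≤ j) (β : EuclideanSpace ℝ (Fin 2)) :
    probRatio k β j = Real.exp ((nSeq k j : ℝ) ^ 2 * rate k β) *
      ((nu (nSeq k j) (vertex (k + 1)) : ℝ) / nu (nSeq k j) (vertex k)) := by
  have h₁ := nu_vertex_left_pos (k := k) hj
  have h₂ := nu_vertex_right_pos (k := k) hj
  rw [probRatio, twoPointProb, twoPointProb, if_pos (Or.inr rfl), if_pos (Or.inl rfl),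
    div_div_div_cancel_right₀ (by positivity), mul_div_mul_comm, ← Real.exp_sub, rate_eq_inner,
    mul_sub]

theorem probRatio_isTheta (k : ℕ) (β : EuclideanSpace ℝ (Fin 2)) :
    probRatio k β =Θ[atTop] fun j : ℕ =>
      Real.exp ((nSeq k j : ℝ) ^ 2 * rate k β) * √(1 / (nSeq k j : ℝ)) *
        (((k : ℝ) + 2) / ((k : ℝ) + 1)) ^ nSeq k j := by
  have h := (isTheta_refl (fun j : ℕ => Real.exp ((nSeq k j : ℝ) ^ 2 * rate k β)) atTop).mul
    (nu_ratio_isTheta k)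
  simp only [← mul_assoc] at h
  exact EventuallyEq.trans_isTheta
    ((eventually_ge_atTop 1).mono fun j hj => probRatio_eq hj β) h

theorem tendsto_nSeq (k : ℕ) : Tendsto (fun j : ℕ => (nSeq k j : ℝ)) atTop atTop := by
  refine tendsto_natCast_atTop_atTop.comp ?_
  exact (tendsto_id.atTop_mul_const' (Nat.succ_pos k)).atTop_mul_const' (Nat.succ_pos (k + 1))

/-- The logarithm is `n log q - (log n)/2 + O(1)`, the bounded error coming from the two constants
in the `Θ` estimate; all of it is `o(n²)`. -/
theorem tendsto_log_nu_ratio (k : ℕ) :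
    Tendsto (fun j : ℕ => Real.log ((nu (nSeq k j) (vertex (k + 1)) : ℝ) /
      nu (nSeq k j) (vertex k)) / (nSeq k j : ℝ) ^ 2) atTop (𝓝 0) := by
  obtain ⟨C, hC, hle⟩ := (nu_ratio_isTheta k).1.exists_pos
  obtain ⟨c, hc, hge⟩ := (nu_ratio_isTheta k).2.exists_pos
  set q : ℝ := ((k : ℝ) + 2) / ((k : ℝ) + 1) with hq
  have hq1 : 1 ≤ q := by rw [hq, le_div_iff₀ (by positivity)]; linarith
  have hq0 : 0 < q := by linarith
  have hlog : Tendsto (fun j : ℕ => Real.log (nSeq k j : ℝ) / (nSeq k j : ℝ) ^ 2) atTop (𝓝 0) := by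
    have := (isLittleO_log_rpow_atTop (r := 2) (by norm_num)).tendsto_div_nhds_zero.comp
      (tendsto_nSeq k)
    simpa [Function.comp_def] using this
  have hinv : Tendsto (fun j : ℕ => ((nSeq k j : ℝ))⁻¹) atTop (𝓝 0) :=
    tendsto_inv_atTop_zero.comp (tendsto_nSeq k)
  have hinv2 : Tendsto (fun j : ℕ => ((nSeq k j : ℝ) ^ 2)⁻¹) atTop (𝓝 0) := by
    simpa using hinv.pow 2
  have hg : ∀ j : ℕ, 1 ≤ j → Real.log (√(1 / (nSeq k j : ℝ)) * q ^ nSeq k j) =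
      nSeq k j * Real.log q - Real.log (nSeq k j) / 2 := by
    intro j hj
    have : (0 : ℝ) < nSeq k j := by unfold nSeq; positivity
    rw [Real.log_mul (Real.sqrt_pos.2 (by positivity)).ne' (by positivity), Real.log_pow,
      Real.log_sqrt (by positivity), one_div, Real.log_inv]
    ring
  have hmain : Tendsto (fun j : ℕ => Real.log (√(1 / (nSeq k j : ℝ)) * q ^ nSeq k j) /
      (nSeq k j : ℝ) ^ 2) atTop (𝓝 0) := by
    have h := (hinv.mul_const (Real.log q)).sub (hlog.div_const 2)
    simp only [zero_mul, zero_div, sub_zero] at h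
    refine h.congr' ((eventually_ge_atTop 1).mono fun j hj => ?_)
    have : (0 : ℝ) < nSeq k j := by unfold nSeq; positivity
    dsimp only
    rw [hg j hj]
    field_simp
  have hupper := (hinv2.const_mul (Real.log C)).add hmain
  have hlower := hmain.sub (hinv2.const_mul (Real.log c))
  rw [mul_zero, add_zero] at hupper
  rw [mul_zero, sub_zero] at hlower
  refine tendsto_of_tendsto_of_tendsto_of_le_of_le' hlower hupper ?_ ?_
  · filter_upwards [eventually_ge_atTop 1, hge.bound] with j hj h
    have hn : (0 : ℝ) < nSeq k j := by unfold nSeq; positivity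
    have hr := div_pos (nu_vertex_right_pos (k := k) hj) (nu_vertex_left_pos (k := k) hj)
    have hgpos : 0 < √(1 / (nSeq k j : ℝ)) * q ^ nSeq k j :=
      mul_pos (Real.sqrt_pos.2 (by positivity)) (by positivity)
    rw [Real.norm_of_nonneg hr.le, Real.norm_of_nonneg hgpos.le] at h
    have := Real.log_le_log hgpos h
    rw [Real.log_mul hc.ne' hr.ne'] at this
    rw [← div_eq_mul_inv, ← sub_div]
    gcongr
    linarith
  · filter_upwards [eventually_ge_atTop 1, hle.bound] with j hj h
    have hn : (0 : ℝ) < nSeq k j := by unfold nSeq; positivity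
    have hr := div_pos (nu_vertex_right_pos (k := k) hj) (nu_vertex_left_pos (k := k) hj)
    have hgpos : 0 < √(1 / (nSeq k j : ℝ)) * q ^ nSeq k j :=
      mul_pos (Real.sqrt_pos.2 (by positivity)) (by positivity)
    rw [Real.norm_of_nonneg hr.le, Real.norm_of_nonneg hgpos.le] at h
    have := Real.log_le_log hr h
    rw [Real.log_mul hC.ne' hgpos.ne'] at this
    rw [← div_eq_mul_inv, ← add_div]
    gcongr

theorem probRatio_pos {k j : ℕ} (hj : 1 ≤ j) (β : EuclideanSpace ℝ (Fin 2)) :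
    0 < probRatio k β j := by
  rw [probRatio_eq hj]
  have h₁ := nu_vertex_left_pos (k := k) hj
  have h₂ := nu_vertex_right_pos (k := k) hj
  positivity

theorem tendsto_log_probRatio (k : ℕ) (β : EuclideanSpace ℝ (Fin 2)) :
    Tendsto (fun j : ℕ => Real.log (probRatio k β j) / (nSeq k j : ℝ) ^ 2) atTop
      (𝓝 (rate k β)) := by
  have h := (tendsto_log_nu_ratio k).const_add (rate k β)
  rw [add_zero] at h
  refine h.congr' ((eventually_ge_atTop 1).mono fun j hj => ?_)
  have hn : (0 : ℝ) < nSeq k j := by unfold nSeq; positivity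
  have hr := div_pos (nu_vertex_right_pos (k := k) hj) (nu_vertex_left_pos (k := k) hj)
  dsimp only
  rw [probRatio_eq hj, Real.log_mul (Real.exp_pos _).ne' hr.ne', Real.log_exp]
  field_simp

/-- The logarithm is `n²` times a quantity with negative limit, so it tends to `-∞`. -/
theorem tendsto_probRatio_of_rate_neg {k : ℕ} {β : EuclideanSpace ℝ (Fin 2)}
    (h : rate k β < 0) : Tendsto (probRatio k β) atTop (𝓝 0) := by
  have hsq : Tendsto (fun j : ℕ => (nSeq k j : ℝ) ^ 2) atTop atTop :=
    (tendsto_pow_atTop two_ne_zero).comp (tendsto_nSeq k)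
  have h' := Real.tendsto_exp_atBot.comp ((tendsto_log_probRatio k β).neg_mul_atTop h hsq)
  refine h'.congr' ((eventually_ge_atTop 1).mono fun j hj => ?_)
  have hn : (0 : ℝ) < nSeq k j := by unfold nSeq; positivity
  simp only [Function.comp_apply]
  rw [div_mul_cancel₀ _ (by positivity), Real.exp_log (probRatio_pos hj β)]

theorem tendsto_sqrt_mul_pow (k : ℕ) :
    Tendsto (fun j : ℕ => √(1 / (nSeq k j : ℝ)) * (((k : ℝ) + 2) / ((k : ℝ) + 1)) ^ nSeq k j)
      atTop atTop := by
  have hq0 : 0 < Real.log (((k : ℝ) + 2) / ((k : ℝ) + 1)) :=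
    Real.log_pos (by rw [lt_div_iff₀ (by positivity)]; linarith)
  have h := (tendsto_exp_mul_div_rpow_atTop (1 / 2) _ hq0).comp (tendsto_nSeq k)
  refine h.congr fun j => ?_
  simp only [Function.comp_apply]
  rw [← Real.sqrt_eq_rpow, mul_comm (Real.log _), ← Real.log_pow, Real.exp_log (by positivity),
    one_div, Real.sqrt_inv]
  ring

/-- The factor `exp (n² · rate)` is at least `1`, so the diverging quotient of counts is a lower
bound up to a constant; this covers rate zero, where the logarithmic limit is uninformative. -/
theorem tendsto_probRatio_of_rate_nonneg {k : ℕ} {β : EuclideanSpace ℝ (Fin 2)}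
    (h : 0 ≤ rate k β) : Tendsto (probRatio k β) atTop atTop := by
  -- A `Θ` estimate transfers divergence of norms only; positivity of the ratio removes the norm
  -- afterwards.
  have h₁ : Tendsto (norm ∘ probRatio k β) atTop atTop := by
    rw [(probRatio_isTheta k β).tendsto_norm_atTop_iff]
    refine tendsto_atTop_mono (fun j => ?_) (tendsto_sqrt_mul_pow k)
    rw [Function.comp_apply, mul_assoc]
    refine le_trans ?_ (Real.le_norm_self _)
    exact le_mul_of_one_le_left (by positivity) (Real.one_le_exp (by positivity))
  refine h₁.congr' ((eventually_ge_atTop 1).mono fun j hj => ?_)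
  exact Real.norm_of_nonneg (probRatio_pos hj β).le

theorem rate_eq_mul_norm (k : ℕ) (β : EuclideanSpace ℝ (Fin 2)) :
    rate k β = inner ℝ (unitDir k) β * ‖vertex (k + 1) - vertex k‖ := by
  rw [rate, inner_vertex_sub_unitDir]

end EdgeTriangle

theorem mainTheorem5 (k : ℕ) (hk : 1 ≤ k) (β : EuclideanSpace ℝ (Fin 2)) :
    -- the limit of the ratio
    (0 ≤ inner ℝ (EdgeTriangle.unitDir k) β →
      Tendsto (EdgeTriangle.probRatio k β) atTop atTop) ∧
    (inner ℝ (EdgeTriangle.unitDir k) β < 0 →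
      Tendsto (EdgeTriangle.probRatio k β) atTop (𝓝 0)) ∧
    -- the rate: exponential in `n²`, with a constant of the same sign as `⟨l_k, β⟩`
    0 < inner ℝ (EdgeTriangle.vertex (k + 1) - EdgeTriangle.vertex k) (EdgeTriangle.unitDir k) ∧
    Tendsto (fun j : ℕ => Real.log (EdgeTriangle.probRatio k β j) /
        (EdgeTriangle.nSeq k j : ℝ) ^ 2) atTop (𝓝 (EdgeTriangle.rate k β)) ∧
    (EdgeTriangle.probRatio k β =Θ[atTop] fun j : ℕ =>
      Real.exp ((EdgeTriangle.nSeq k j : ℝ) ^ 2 * EdgeTriangle.rate k β) *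
        Real.sqrt (1 / (EdgeTriangle.nSeq k j : ℝ)) *
        (((k : ℝ) + 2) / ((k : ℝ) + 1)) ^ EdgeTriangle.nSeq k j) ∧
    -- the count of labeled balanced Turán graphs
    (∀ j : ℕ, 1 ≤ j →
      EdgeTriangle.nu (EdgeTriangle.nSeq k j) (EdgeTriangle.vertex k) =
          EdgeTriangle.turanCount (EdgeTriangle.nSeq k j) (k + 1) ∧
      EdgeTriangle.nu (EdgeTriangle.nSeq k j) (EdgeTriangle.vertex (k + 1)) =
          EdgeTriangle.turanCount (EdgeTriangle.nSeq k j) (k + 2) ∧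
      (EdgeTriangle.turanCount (EdgeTriangle.nSeq k j) (k + 1) : ℝ) =
          ((EdgeTriangle.nSeq k j).factorial : ℝ) /
            (((k + 1).factorial : ℝ) * ((j * (k + 2)).factorial : ℝ) ^ (k + 1)) ∧
      (EdgeTriangle.turanCount (EdgeTriangle.nSeq k j) (k + 2) : ℝ) =
          ((EdgeTriangle.nSeq k j).factorial : ℝ) /
            (((k + 2).factorial : ℝ) * ((j * (k + 1)).factorial : ℝ) ^ (k + 2))) ∧
    ((fun j : ℕ =>
        (EdgeTriangle.nu (EdgeTriangle.nSeq k j) (EdgeTriangle.vertex (k + 1)) : ℝ) /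
          (EdgeTriangle.nu (EdgeTriangle.nSeq k j) (EdgeTriangle.vertex k) : ℝ)) =Θ[atTop]
      fun j : ℕ => Real.sqrt (1 / (EdgeTriangle.nSeq k j : ℝ)) *
        (((k : ℝ) + 2) / ((k : ℝ) + 1)) ^ EdgeTriangle.nSeq k j) := by
  refine ⟨fun h => ?_, fun h => ?_, ?_, EdgeTriangle.tendsto_log_probRatio k β,
    EdgeTriangle.probRatio_isTheta k β, fun j hj => ?_, EdgeTriangle.nu_ratio_isTheta k⟩
  · refine EdgeTriangle.tendsto_probRatio_of_rate_nonneg ?_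
    rw [EdgeTriangle.rate_eq_mul_norm]
    exact mul_nonneg h (norm_nonneg _)
  · refine EdgeTriangle.tendsto_probRatio_of_rate_neg ?_
    rw [EdgeTriangle.rate_eq_mul_norm]
    exact mul_neg_of_neg_of_pos h (EdgeTriangle.norm_vertex_sub_pos k)
  · rw [EdgeTriangle.inner_vertex_sub_unitDir]
    exact EdgeTriangle.norm_vertex_sub_pos k
  · exact ⟨EdgeTriangle.nu_vertex_left hj, EdgeTriangle.nu_vertex_right hj,
      EdgeTriangle.turanCount_left hj, EdgeTriangle.turanCount_right hj⟩
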